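/- **Setting.** Let $G=(V,E)$ be an infinite, connected, locally finite graph with graph distance $d$, and let $N_x$ be the set of neighbours of $x$. For $o\in V$ put $L_r=\{x: d(x,o)=r\}$ and let $B_r$ be the ball $\{x: d(x,o)\le r\}$, $r\ge 0$. For $g>0$, the graph $G$ is called $(g,o)$-growing if $$\min_{r\ge 0,\ x\in L_r}\bigl\{|N_x\cap L_{r+1}|-|N_x\cap B_r|\bigr\}=g .$$ For a finite $A\subset V$ let $\partial_V A$ be the set of vertices outside $A$ that have a neighbour in $A$. For $\eta\in\{\pm1\}^V$ let $\mu_A^\eta$ be the Ising Gibbs measure on $A$ at inverse temperature $\beta$ and zero external field: it is supported on the configurations $\sigma\in\{\pm1\}^{A\cup\partial_V A}$ that agree with $\eta$ on $\partial_V A$, and there $$\mu_A^\eta(\sigma)=\frac1Z\exp\Bigl(\beta\sum_{\{u,v\}}\sigma_u\sigma_v\Bigr),$$ where the sum runs over the edges of the subgraph induced on $A\cup\partial_V A$ and $Z$ is the normalizing constant. **Proposition.** For every $\Delta$ there is a constant $\delta=\delta(\Delta)>0$ such that for every $g>0$ and every $\beta>\frac{\delta}{2g}$ there is a constant $c=c(\Delta,g,\beta)>0$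 with the following property. Let $G$ be a $(g,o)$-growing graph with maximal degree $\Delta$, let $0\le i\le m$ be integers, let $S\subset L_i$, $x\in S$, $y\in L_i\setminus S$, and let $U=(B_m\setminus B_i)\cup S$. Let $\tau\in\{\pm1\}^V$ satisfy $\tau_z=+1$ for all $z\in\partial_V B_m$, and let $\tau^y$ be the configuration obtained from $\tau$ by flipping the spin at $y$. Then $$\bigl|\mu_U^{\tau}(\sigma_x=+)-\mu_U^{\tau^y}(\sigma_x=+)\bigr|\le c\,e^{-(2g\beta-\delta)\,d(x,y)} .$$ -/

import Mathlib

namespace GrowingIsing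

variable {V : Type*} (G : SimpleGraph V)

/-- The level `L_r(o)`: the vertices at graph distance exactly `r` from `o`. The extended distance
`edist` equals the graph distance on connected graphs (and is `⊤` between different components). -/
def level (o : V) (r : ℕ) : Set V := {x | G.edist o x = r}

/-- The vertex set of the ball of radius `r` centered at `o`. -/
def ballSet (o : V) (r : ℕ) : Set V := {x | G.edist o x ≤ r}

/-- `G` is a `(g, o)`-growing graph: it is infinite, `g > 0`, and the minimum over all `r ≥ 0` and
`x ∈ L_r(o)` of `|N_x ∩ L_{r+1}(o)| - |N_x ∩ B_r(o)|` (an integer) exists and equals `g`. -/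
structure IsGrowing (g : ℕ) (o : V) : Prop where
  infinite : Infinite V
  pos : 0 < g
  isLeast : IsLeast
    {k : ℤ | ∃ r : ℕ, ∃ x ∈ level G o r,
      k = ((G.neighborSet x ∩ level G o (r + 1)).ncard : ℤ)
        - ((G.neighborSet x ∩ ballSet G o r).ncard : ℤ)} (g : ℤ)

theorem finite_ballSet [G.LocallyFinite] (o : V) (r : ℕ) : (ballSet G o r).Finite := by
  induction r with
  | zero =>
    refine (Set.finite_singleton o).subset fun x hx => ?_
    have h : G.edist o x = 0 := nonpos_iff_eq_zero.mp hx
    exact (SimpleGraph.edist_eq_zero_iff.mp h).symm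
  | succ r ih =>
    refine (ih.union (ih.biUnion fun y _ => (G.neighborSet y).toFinite)).subset fun x hx => ?_
    have hx' : G.edist o x ≤ ((r + 1 : ℕ) : ℕ∞) := hx
    have hr : G.Reachable o x := by
      rw [← SimpleGraph.edist_ne_top_iff_reachable]
      exact ne_top_of_le_ne_top (ENat.natCast_ne_top _) hx'
    obtain ⟨p, hp⟩ := hr.symm.exists_walk_length_eq_edist
    rw [SimpleGraph.edist_comm, ← hp] at hx'
    have hlen : p.length ≤ r + 1 := by exact_mod_cast hx'
    cases p with
    | nil => exact Or.inl (by simp [ballSet])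
    | @cons _ w _ h q =>
      refine Or.inr (Set.mem_biUnion (x := w) ?_ h.symm)
      have h1 : q.length ≤ r := by simpa using hlen
      have h2 : G.edist w o ≤ q.length := SimpleGraph.Walk.edist_le q
      rw [SimpleGraph.edist_comm] at h2
      exact h2.trans (by exact_mod_cast h1)

/-- The ball `B_r(o)` as a finite set of vertices. -/
noncomputable def ball [G.LocallyFinite] (o : V) (r : ℕ) : Finset V :=
  (finite_ballSet G o r).toFinset

/-- The vertex boundary `∂_V A`: the vertices outside `A` with a neighbour in `A`. -/
noncomputable def vertexBoundary [G.LocallyFinite] (A : Finset V) : Finset V :=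
  open scoped Classical in (A.biUnion fun y => G.neighborFinset y).filter fun x => x ∉ A

/-- `A ∪ ∂_V A`. -/
noncomputable def closure [G.LocallyFinite] (A : Finset V) : Finset V :=
  open scoped Classical in A ∪ vertexBoundary G A

/-- Spin configurations in `{±1}^{A ∪ ∂_V A}`; the group `ℤˣ` is `{1, -1}`. -/
abbrev Config [G.LocallyFinite] (A : Finset V) : Type _ := {x // x ∈ closure G A} → ℤˣ

/-- `Ω_A^η`: the configurations on `A ∪ ∂_V A` that agree with `η` on `∂_V A`. -/
def Omega [G.LocallyFinite] (A : Finset V) (η : V → ℤˣ) : Set (Config G A) :=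
  {σ | ∀ z : {x // x ∈ closure G A}, (z : V) ∈ vertexBoundary G A → σ z = η z}

/-- The sum of `σ_x σ_y` over all (unordered) edges of the subgraph of `G` induced on
`A ∪ ∂_V A`. -/
noncomputable def interaction [G.LocallyFinite] (A : Finset V) (σ : Config G A) : ℝ :=
  open scoped Classical in
  ∑ e ∈ (G.comap (Subtype.val : {x // x ∈ closure G A} → V)).edgeFinset,
    e.lift ⟨fun x y => ((σ x : ℤ) : ℝ) * ((σ y : ℤ) : ℝ), fun _ _ => mul_comm _ _⟩

/-- The partition function of the Ising model on `A` with boundary condition `η`. -/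
noncomputable def partitionFunction [G.LocallyFinite] (β : ℝ) (A : Finset V) (η : V → ℤˣ) : ℝ :=
  open scoped Classical in
  ∑ σ : Config G A with σ ∈ Omega G A η, Real.exp (β * interaction G A σ)

/-- The Gibbs measure `μ_A^η` (inverse temperature `β`, zero external field), as a mass function
on configurations, supported on `Ω_A^η`. -/
noncomputable def gibbs [G.LocallyFinite] (β : ℝ) (A : Finset V) (η : V → ℤˣ)
    (σ : Config G A) : ℝ :=
  open scoped Classical in
  if σ ∈ Omega G A η then Real.exp (β * interaction G A σ) / partitionFunction G β A η else 0

/-- The probability `μ_A^η(E)` of an event `E`. -/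
noncomputable def gibbsProb [G.LocallyFinite] (β : ℝ) (A : Finset V) (η : V → ℤˣ)
    (E : Set (Config G A)) : ℝ :=
  open scoped Classical in ∑ σ : Config G A with σ ∈ E, gibbs G β A η σ

/-- The event `{σ_x = +}`, for a vertex `x` of `A ∪ ∂_V A`. -/
def plusAt [G.LocallyFinite] (A : Finset V) (x : V) : Set (Config G A) :=
  {σ | ∃ h : x ∈ closure G A, σ ⟨x, h⟩ = 1}

/-- The configuration `τ^y`: the spin of `τ` at `y` is flipped, all others are kept. -/
noncomputable def flipAt (τ : V → ℤˣ) (y : V) : V → ℤˣ :=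
  open scoped Classical in Function.update τ y (-τ y)

/-- `F_i = B_m ∖ B_{i-1}`, i.e. the vertices of `B_m` at distance at least `i` from `o`. -/
noncomputable def outerLayers [G.LocallyFinite] (o : V) (m i : ℕ) : Finset V :=
  open scoped Classical in (ball G o m).filter fun x => (i : ℕ∞) ≤ G.edist o x

/-- `U = F_{i+1} ∪ S`. -/
noncomputable def region [G.LocallyFinite] (o : V) (m i : ℕ) (S : Finset V) : Finset V :=
  open scoped Classical in outerLayers G o m (i + 1) ∪ S

/-- The mass function `gibbs` is normalized. -/
theorem gibbsProb_univ [G.LocallyFinite] (β : ℝ) (A : Finset V) (η : V → ℤˣ) :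
    gibbsProb G β A η Set.univ = 1 := by
  classical
  have hpos : 0 < partitionFunction G β A η := by
    unfold partitionFunction
    refine Finset.sum_pos (fun _ _ => Real.exp_pos _) ⟨fun z => η z, ?_⟩
    simp [Omega]
  have h : gibbsProb G β A η Set.univ
      = partitionFunction G β A η / partitionFunction G β A η := by
    conv_rhs => enter [1]; unfold partitionFunction
    simp only [gibbsProb, gibbs, Set.mem_univ, Finset.filter_true, Finset.sum_div]
    rw [Finset.sum_filter]
  rw [h, div_self hpos.ne']

end GrowingIsing

/-! Take two independent samples, one with boundary condition `τ` and one with `τ^y`, and let the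
cluster of `x` be its component in the set of vertices of `U` where the two spins are not both plus.
If no vertex of the cluster is adjacent to `y`, exchanging the samples on it preserves the product
weight and reverses the sign of the contribution to the difference at `x`, so these contributions
cancel. The difference of probabilities is thus at most the probability that the cluster reaches a
neighbour of `y` (`abs_sub_le_sum_adj_cluster`).

A Peierls argument bounds that probability. Just outside the cluster, inside `U`, both samples are
plus, and above `U` the boundary is plus. By the growth condition, turning `k` minus spins of the
cluster into plus multiplies the weight by at least `exp(2βgk)` (`energy_le_energy_plusOn`). The
minus sets of the two samples cover the cluster `C`, so a given `C` costs at most `(4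
exp(-2βg))^|C|`, where `4^|C|` counts the pairs of minus sets (`sum_weight_cluster_eq_le`). At most
`Δ^(2(n-1))` sets of size `n` can be the cluster (`cluster_mem_walkSupports`), and reaching `y`
forces `n ≥ d(x,y)`. A geometric series finishes the proof. -/

namespace GrowingIsing

/-! ### Counting connected sets by walks -/

section WalkSupports

variable {X : Type*} [Fintype X] (H : SimpleGraph X)

open scoped Classical in
/-- The vertex sets of the walks of length `n` starting at `x`. -/
noncomputable def walkSupports : ℕ → X → Finset (Finset X)
  | 0, x => {{x}}
  | n + 1, x => (H.neighborFinset x).biUnion fun u => (walkSupports n u).image (insert x)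

open scoped Classical in
theorem support_toFinset_mem_walkSupports {x z : X} (p : H.Walk x z) :
    p.support.toFinset ∈ walkSupports H p.length x := by
  induction p with
  | nil => simp [walkSupports]
  | @cons u v w h p ih =>
    simp only [SimpleGraph.Walk.support_cons, List.toFinset_cons, SimpleGraph.Walk.length_cons,
      walkSupports, Finset.mem_biUnion, SimpleGraph.mem_neighborFinset]
    exact ⟨v, h, Finset.mem_image_of_mem _ ih⟩

open scoped Classical in
theorem card_walkSupports_le {Δ : ℕ} (hΔ : ∀ u, H.degree u ≤ Δ) (n : ℕ) (x : X) :
    (walkSupports H n x).card ≤ Δ ^ n := by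
  induction n generalizing x with
  | zero => simp [walkSupports]
  | succ n ih =>
    rw [walkSupports, pow_succ']
    refine (Finset.card_biUnion_le_card_mul _ _ (Δ ^ n) fun u _ =>
      Finset.card_image_le.trans (ih u)).trans ?_
    exact Nat.mul_le_mul_right _ (hΔ x)

/-- A finite set that can be exhausted from `x` along edges is the vertex set of a closed walk
from `x` that traverses each edge of a spanning tree twice. -/
theorem mem_walkSupports_of_connected {x : X} {C : Finset X} (hx : x ∈ C)
    (hC : ∀ T ⊆ C, x ∈ T → T ≠ C → ∃ t ∈ T, ∃ c ∈ C, c ∉ T ∧ H.Adj t c) :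
    C ∈ walkSupports H (2 * (C.card - 1)) x := by
  classical
  have key : ∀ n, n + 1 ≤ C.card → ∃ p : H.Walk x x, p.length = 2 * n ∧
      p.support.toFinset ⊆ C ∧ p.support.toFinset.card = n + 1 := by
    intro n
    induction n with
    | zero => exact fun _ => ⟨.nil, by simp [hx]⟩
    | succ n ih =>
      intro hn
      obtain ⟨p, hl, hs, hc⟩ := ih (by omega)
      obtain ⟨t, ht, c, hcC, hcT, hadj⟩ := hC _ hs (by simp) (by rintro h; rw [h] at hc; omega)
      have ht' : t ∈ p.support := by simpa using ht
      -- The detour `t → c → t`, inserted at a visit to `t`, adds two steps and one new vertex.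
      let q : H.Walk x x :=
        (p.takeUntil t ht').append (.cons hadj (.cons hadj.symm (p.dropUntil t ht')))
      have hq : q.support.toFinset = insert c p.support.toFinset := by
        ext z
        have hz : z ∈ p.support ↔ z ∈ (p.takeUntil t ht').support ∨
            z ∈ (p.dropUntil t ht').support := by
          rw [← SimpleGraph.Walk.mem_support_append_iff, p.take_spec]
        have h1 : t ∈ (p.dropUntil t ht').support := SimpleGraph.Walk.start_mem_support _
        simp only [q, List.mem_toFinset, SimpleGraph.Walk.mem_support_append_iff,
          SimpleGraph.Walk.support_cons, List.mem_cons, Finset.mem_insert, hz]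
        constructor
        · rintro (h | rfl | rfl | h) <;> tauto
        · tauto
      refine ⟨q, ?_, ?_, ?_⟩
      · have := congrArg SimpleGraph.Walk.length (p.take_spec ht')
        simp only [SimpleGraph.Walk.length_append] at this
        simp only [q, SimpleGraph.Walk.length_append, SimpleGraph.Walk.length_cons]
        omega
      · rw [hq]; exact Finset.insert_subset hcC hs
      · rw [hq, Finset.card_insert_of_notMem hcT, hc]
  have hpos : 0 < C.card := Finset.card_pos.mpr ⟨x, hx⟩
  obtain ⟨p, hl, hs, hc⟩ := key (C.card - 1) (by omega)
  have : p.support.toFinset = C := Finset.eq_of_subset_of_card_le hs (by omega)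
  rw [← this, hc, Nat.add_sub_cancel, ← hl]
  exact support_toFinset_mem_walkSupports H p

end WalkSupports

/-! ### Energy gain from turning minus spins into plus -/

section Weights

variable {X : Type*} [Fintype X] (H : SimpleGraph X)

open scoped Classical in
/-- The sum of `σ_u σ_v` over all ordered pairs of adjacent vertices. -/
noncomputable def energy (σ : X → ℤˣ) : ℝ :=
  ∑ u, ∑ v, if H.Adj u v then ((σ u : ℤ) : ℝ) * ((σ v : ℤ) : ℝ) else 0

open scoped Classical in
/-- The unnormalized Gibbs weight of `σ` with free spins on `U` and boundary condition `τ`. -/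
noncomputable def weight (β : ℝ) (U : Finset X) (τ σ : X → ℤˣ) : ℝ :=
  if ∀ z ∉ U, σ z = τ z then Real.exp (β / 2 * energy H σ) else 0

theorem weight_nonneg (β : ℝ) (U : Finset X) (τ σ : X → ℤˣ) : 0 ≤ weight H β U τ σ := by
  unfold weight; split_ifs <;> positivity

open scoped Classical in
theorem sum_weight_pos (β : ℝ) (U : Finset X) (τ : X → ℤˣ) : 0 < ∑ σ, weight H β U τ σ := by
  refine Finset.sum_pos' (fun σ _ => weight_nonneg H β U τ σ) ⟨τ, Finset.mem_univ _, ?_⟩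
  rw [weight, if_pos fun _ _ => rfl]
  positivity

open scoped Classical in
/-- The configuration obtained from `σ` by setting the spins in `A` to `+`. -/
noncomputable def plusOn (A : Finset X) (σ : X → ℤˣ) : X → ℤˣ := fun z => if z ∈ A then 1 else σ z

open scoped Classical in
/-- `g` is a lower bound on the excess of upward neighbours over other neighbours, on `U`. -/
def UpwardGrowth (ℓ : X → ℕ) (U : Finset X) (g : ℝ) : Prop :=
  ∀ u ∈ U, g ≤ ∑ v, if H.Adj u v then (if ℓ u < ℓ v then (1 : ℝ) else -1) else 0

theorem spin_mem (s : ℤˣ) : ((s : ℤ) : ℝ) = 1 ∨ ((s : ℤ) : ℝ) = -1 := by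
  rcases Int.units_eq_one_or s with h | h <;> simp [h]

open scoped Classical in
-- An edge inside `A` keeps its energy, and its two signs `s u v`, `s v u` add up to at most 0,
-- since at most one direction is upward. An upward edge leaving `A` passes from -1 to 1, and any
-- other edge leaving `A` loses at most 2. Summing the signs over `A` gives at least `g` per vertex.
-- The factor 4 is a gain of 2 per edge, doubled because `energy` counts ordered pairs.
theorem energy_le_energy_plusOn {ℓ : X → ℕ} {U : Finset X} {g : ℝ} (hg : UpwardGrowth H ℓ U g)
    {A : Finset X} (hA : A ⊆ U) {σ : X → ℤˣ} (hσ : ∀ u ∈ A, σ u = -1)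
    (hup : ∀ u ∈ A, ∀ v ∉ A, H.Adj u v → ℓ u < ℓ v → σ v = 1) :
    energy H σ ≤ energy H (plusOn A σ) - 4 * g * A.card := by
  set s : X → X → ℝ := fun u v => if H.Adj u v then (if ℓ u < ℓ v then (1 : ℝ) else -1) else 0
    with hs
  have hgrow : g * A.card ≤ ∑ u, ∑ v, if u ∈ A then s u v else 0 := by
    have h1 : ∀ u, (∑ v, if u ∈ A then s u v else 0) = if u ∈ A then ∑ v, s u v else 0 := by
      intro u; split_ifs <;> simp
    simp only [h1]
    rw [Finset.sum_ite_mem, Finset.univ_inter, mul_comm, ← nsmul_eq_mul]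
    exact Finset.card_nsmul_le_sum _ _ _ fun u hu => hg u (hA hu)
  have hgrow' : g * A.card ≤ ∑ u, ∑ v, if v ∈ A then s v u else 0 := by
    rw [Finset.sum_comm]; exact hgrow
  have hterm : ∀ u v, (if H.Adj u v then ((σ u : ℤ) : ℝ) * ((σ v : ℤ) : ℝ) else 0)
      + 2 * (if u ∈ A then s u v else 0) + 2 * (if v ∈ A then s v u else 0)
      ≤ (if H.Adj u v then ((plusOn A σ u : ℤ) : ℝ) * ((plusOn A σ v : ℤ) : ℝ) else 0) := by
    intro u v
    by_cases hadj : H.Adj u v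
    · have hadj' := hadj.symm
      simp only [hs, if_pos hadj, if_pos hadj', plusOn]
      by_cases hu : u ∈ A <;> by_cases hv : v ∈ A
      · simp only [hu, hv, if_true, hσ u hu, hσ v hv]
        by_cases h1 : ℓ u < ℓ v
        · simp [h1, h1.le.not_gt]
        · by_cases h2 : ℓ v < ℓ u <;> simp [h1, h2]
      · simp only [hu, hv, if_true, if_false, hσ u hu]
        by_cases h1 : ℓ u < ℓ v
        · simp [h1, hup u hu v hv hadj h1]; norm_num
        · rcases spin_mem (σ v) with h | h <;> simp [h1, h] <;> norm_num
      · simp only [hu, hv, if_true, if_false, hσ v hv]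
        by_cases h1 : ℓ v < ℓ u
        · simp [h1, hup v hv u hu hadj' h1]; norm_num
        · rcases spin_mem (σ u) with h | h <;> simp [h1, h] <;> norm_num
      · simp [hu, hv]
    · have hadj' : ¬ H.Adj v u := fun h => hadj h.symm
      simp [hs, hadj, hadj']
  have hsum := Finset.sum_le_sum fun u (_ : u ∈ Finset.univ) =>
    Finset.sum_le_sum fun v (_ : v ∈ Finset.univ) => hterm u v
  simp only [Finset.sum_add_distrib, ← Finset.mul_sum] at hsum
  unfold energy
  linarith

theorem weight_le_weight_plusOn {β : ℝ} (hβ : 0 ≤ β) {ℓ : X → ℕ} {U : Finset X} {g : ℝ}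
    (hg : UpwardGrowth H ℓ U g) {A : Finset X} (hA : A ⊆ U) {τ σ : X → ℤˣ}
    (hσ : ∀ u ∈ A, σ u = -1)
    (hup : ∀ u ∈ A, ∀ v ∉ A, H.Adj u v → ℓ u < ℓ v → σ v = 1) :
    weight H β U τ σ ≤ Real.exp (-(2 * β * g)) ^ A.card * weight H β U τ (plusOn A σ) := by
  unfold weight
  by_cases h : ∀ z ∉ U, σ z = τ z
  · have h' : ∀ z ∉ U, plusOn A σ z = τ z := fun z hz => by
      rw [plusOn, if_neg fun hzA => hz (hA hzA), h z hz]
    rw [if_pos h, if_pos h', ← Real.exp_nat_mul, ← Real.exp_add, Real.exp_le_exp]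
    have := mul_le_mul_of_nonneg_left (energy_le_energy_plusOn H hg hA hσ hup)
      (by positivity : 0 ≤ β / 2)
    linarith
  · rw [if_neg h]
    exact mul_nonneg (by positivity) (by split_ifs <;> positivity)

end Weights


/-! ### Clusters of the doubled system and the swap -/

section Swapping

variable {X : Type*} [Fintype X] (H : SimpleGraph X)

open scoped Classical in
/-- The cluster of `x` in the set of the vertices of `U` at which not both spins are `+`. -/
noncomputable def cluster (U : Finset X) (x : X) (p : (X → ℤˣ) × (X → ℤˣ)) : Finset X :=
  {v | ∃ q : H.Walk x v, ∀ u ∈ q.support, u ∈ U ∧ ¬ (p.1 u = 1 ∧ p.2 u = 1)}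

variable {H} {U : Finset X} {x : X} {p : (X → ℤˣ) × (X → ℤˣ)}

theorem mem_cluster {v : X} : v ∈ cluster H U x p ↔
    ∃ q : H.Walk x v, ∀ u ∈ q.support, u ∈ U ∧ ¬ (p.1 u = 1 ∧ p.2 u = 1) := by
  simp [cluster]

theorem cluster_spec {v : X} (hv : v ∈ cluster H U x p) :
    v ∈ U ∧ ¬ (p.1 v = 1 ∧ p.2 v = 1) := by
  obtain ⟨q, hq⟩ := mem_cluster.mp hv
  exact hq v q.end_mem_support

theorem cluster_subset : cluster H U x p ⊆ U := fun _ hv => (cluster_spec hv).1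

theorem start_mem_cluster {v : X} (hv : v ∈ cluster H U x p) : x ∈ cluster H U x p := by
  obtain ⟨q, hq⟩ := mem_cluster.mp hv
  exact mem_cluster.mpr ⟨.nil, by simpa using hq x q.start_mem_support⟩

theorem mem_cluster_of_mem_support {v u : X} {q : H.Walk x v}
    (hq : ∀ u ∈ q.support, u ∈ U ∧ ¬ (p.1 u = 1 ∧ p.2 u = 1)) (hu : u ∈ q.support) :
    u ∈ cluster H U x p := by
  classical
  exact mem_cluster.mpr ⟨q.takeUntil u hu, fun w hw => hq w (q.support_takeUntil_subset_support hu hw)⟩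

theorem plus_of_adj_cluster {u v : X} (hu : u ∈ cluster H U x p) (hv : v ∉ cluster H U x p)
    (hadj : H.Adj u v) (hvU : v ∈ U) : p.1 v = 1 ∧ p.2 v = 1 := by
  by_contra hne
  obtain ⟨q, hq⟩ := mem_cluster.mp hu
  refine hv (mem_cluster.mpr ⟨q.concat hadj, fun w hw => ?_⟩)
  rw [SimpleGraph.Walk.support_concat, List.mem_append, List.mem_singleton] at hw
  rcases hw with hw | rfl
  · exact hq w hw
  · exact ⟨hvU, hne⟩

theorem plus_of_notMem_cluster (hx : x ∈ U) (h : x ∉ cluster H U x p) :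
    p.1 x = 1 ∧ p.2 x = 1 := by
  by_contra hne
  exact h (mem_cluster.mpr ⟨.nil, by simpa using ⟨hx, by simpa using hne⟩⟩)

theorem cluster_mem_walkSupports (hne : (cluster H U x p).Nonempty) :
    cluster H U x p ∈ walkSupports H (2 * ((cluster H U x p).card - 1)) x := by
  obtain ⟨v, hv⟩ := hne
  refine mem_walkSupports_of_connected H (start_mem_cluster hv) fun T hT hxT hTC => ?_
  obtain ⟨c, hc, hcT⟩ : ∃ c ∈ cluster H U x p, c ∉ T := by
    by_contra! h
    exact hTC (hT.antisymm h)
  obtain ⟨q, hq⟩ := mem_cluster.mp hc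
  obtain ⟨d, hd, h1, h2⟩ := q.exists_boundary_dart (T : Set X) hxT hcT
  exact ⟨d.fst, h1, d.snd, mem_cluster_of_mem_support hq (q.dart_snd_mem_support_of_mem_darts hd),
    h2, d.adj⟩

/-- A path from `x` to `v` inside the cluster, extended by the edge to `y`, has at least `d` edges;
the path itself therefore has at least `d` vertices. -/
theorem le_card_cluster_of_adj {d : ℕ} {y v : X} (hd : ∀ q : H.Walk x y, d ≤ q.length)
    (hv : v ∈ cluster H U x p) (hadj : H.Adj v y) : d ≤ (cluster H U x p).card := by
  classical
  obtain ⟨q, hq⟩ := mem_cluster.mp hv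
  have h1 := hd (q.bypass.concat hadj)
  rw [SimpleGraph.Walk.length_concat] at h1
  have h2 : q.bypass.support.toFinset ⊆ cluster H U x p := fun w hw =>
    mem_cluster_of_mem_support hq (q.support_bypass_subset_support (by simpa using hw))
  have h3 := Finset.card_le_card h2
  rw [List.toFinset_card_of_nodup q.bypass_isPath.support_nodup,
    SimpleGraph.Walk.length_support] at h3
  omega

open scoped Classical in
/-- Exchange the two configurations on `C`. -/
noncomputable def swapOn (C : Finset X) (p : (X → ℤˣ) × (X → ℤˣ)) : (X → ℤˣ) × (X → ℤˣ) :=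
  (fun z => if z ∈ C then p.2 z else p.1 z, fun z => if z ∈ C then p.1 z else p.2 z)

omit [Fintype X] in
theorem swapOn_swapOn (C : Finset X) (p : (X → ℤˣ) × (X → ℤˣ)) : swapOn C (swapOn C p) = p := by
  ext z <;> by_cases hz : z ∈ C <;> simp [swapOn, hz]

/-- "Both plus" is symmetric in the two configurations. Hence swapping on the cluster is an
involution. -/
theorem cluster_swapOn (C : Finset X) : cluster H U x (swapOn C p) = cluster H U x p := by
  ext v
  rw [mem_cluster, mem_cluster]
  have h : ∀ u, ((swapOn C p).1 u = 1 ∧ (swapOn C p).2 u = 1) ↔ (p.1 u = 1 ∧ p.2 u = 1) := by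
    intro u
    by_cases hu : u ∈ C <;> simp [swapOn, hu, and_comm]
  simp only [h]

/-- Across the interface the outer spin is the same in both copies, so the swap only permutes the
two edge terms. -/
theorem energy_swapOn {C : Finset X} (h : ∀ u ∈ C, ∀ v ∉ C, H.Adj u v → p.1 v = p.2 v) :
    energy H (swapOn C p).1 + energy H (swapOn C p).2 = energy H p.1 + energy H p.2 := by
  classical
  unfold energy
  simp only [← Finset.sum_add_distrib]
  refine Finset.sum_congr rfl fun u _ => Finset.sum_congr rfl fun v _ => ?_
  by_cases hadj : H.Adj u v
  · by_cases hu : u ∈ C <;> by_cases hv : v ∈ C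
    · simp [hadj, swapOn, hu, hv, add_comm]
    · simp [hadj, swapOn, hu, hv, h u hu v hv hadj, add_comm]
    · simp [hadj, swapOn, hu, hv, h v hv u hu hadj.symm, add_comm]
    · simp [hadj, swapOn, hu, hv]
  · simp [hadj]

theorem weight_swapOn (β : ℝ) {C : Finset X} (hC : C ⊆ U) {τ τ' : X → ℤˣ}
    (h : ∀ u ∈ C, ∀ v ∉ C, H.Adj u v → v ∈ U → p.1 v = p.2 v)
    (hτ : ∀ u ∈ C, ∀ v ∉ U, H.Adj u v → τ v = τ' v) :
    weight H β U τ (swapOn C p).1 * weight H β U τ' (swapOn C p).2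
      = weight H β U τ p.1 * weight H β U τ' p.2 := by
  have hout : ∀ z ∉ U, z ∉ C := fun z hz hzC => hz (hC hzC)
  have h1 : (∀ z ∉ U, (swapOn C p).1 z = τ z) ↔ ∀ z ∉ U, p.1 z = τ z :=
    forall₂_congr fun z hz => by simp [swapOn, hout z hz]
  have h2 : (∀ z ∉ U, (swapOn C p).2 z = τ' z) ↔ ∀ z ∉ U, p.2 z = τ' z :=
    forall₂_congr fun z hz => by simp [swapOn, hout z hz]
  unfold weight
  by_cases g1 : ∀ z ∉ U, p.1 z = τ z
  · by_cases g2 : ∀ z ∉ U, p.2 z = τ' z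
    · rw [if_pos g1, if_pos g2, if_pos (h1.mpr g1), if_pos (h2.mpr g2), ← Real.exp_add, ← Real.exp_add, ← mul_add,
        ← mul_add, energy_swapOn]
      intro u hu v hv hadj
      by_cases hvU : v ∈ U
      · exact h u hu v hv hadj hvU
      · rw [g1 v hvU, g2 v hvU, hτ u hu v hvU hadj]
    · rw [if_neg g2, if_neg (mt h2.mp g2), mul_zero, mul_zero]
  · rw [if_neg g1, if_neg (mt h1.mp g1), zero_mul, zero_mul]

open scoped Classical in
theorem abs_sub_le_sum_adj_cluster (β : ℝ) (hx : x ∈ U) {y : X} {τ τ' : X → ℤˣ}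
    (hτ : ∀ v, v ≠ y → τ v = τ' v) :
    |(∑ σ, if σ x = 1 then weight H β U τ σ else 0) * ∑ σ, weight H β U τ' σ
      - (∑ σ, if σ x = 1 then weight H β U τ' σ else 0) * ∑ σ, weight H β U τ σ|
    ≤ ∑ p : (X → ℤˣ) × (X → ℤˣ) with ∃ v ∈ cluster H U x p, H.Adj v y,
        weight H β U τ p.1 * weight H β U τ' p.2 := by
  set F : (X → ℤˣ) × (X → ℤˣ) → ℝ := fun p => weight H β U τ p.1 * weight H β U τ' p.2 *
    ((if p.1 x = 1 then 1 else 0) - (if p.2 x = 1 then 1 else 0)) with hF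
  have hsum : (∑ σ, if σ x = 1 then weight H β U τ σ else 0) * ∑ σ, weight H β U τ' σ
      - (∑ σ, if σ x = 1 then weight H β U τ' σ else 0) * ∑ σ, weight H β U τ σ = ∑ p, F p := by
    rw [Finset.sum_mul_sum, mul_comm (∑ σ, if σ x = 1 then weight H β U τ' σ else 0),
      Finset.sum_mul_sum, ← Finset.sum_sub_distrib, Fintype.sum_prod_type]
    refine Finset.sum_congr rfl fun σ _ => ?_
    rw [← Finset.sum_sub_distrib]
    refine Finset.sum_congr rfl fun σ' _ => ?_
    by_cases h1 : σ x = 1 <;> by_cases h2 : σ' x = 1 <;> simp [hF, h1, h2]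
  have hzero : ∑ p with ¬ ∃ v ∈ cluster H U x p, H.Adj v y, F p = 0 := by
    have hneg : ∑ p with ¬ ∃ v ∈ cluster H U x p, H.Adj v y, F p
        = ∑ p with ¬ ∃ v ∈ cluster H U x p, H.Adj v y, - F p := by
      refine Finset.sum_nbij' (fun p => swapOn (cluster H U x p) p)
        (fun p => swapOn (cluster H U x p) p) ?_ ?_ ?_ ?_ ?_
      · intro p hp; simpa [cluster_swapOn] using hp
      · intro p hp; simpa [cluster_swapOn] using hp
      · intro p _; simp only [cluster_swapOn, swapOn_swapOn]
      · intro p _; simp only [cluster_swapOn, swapOn_swapOn]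
      · intro p hp
        replace hp : ¬ ∃ v ∈ cluster H U x p, H.Adj v y := by simpa using hp
        have hw := weight_swapOn (H := H) (U := U) (p := p) β (C := cluster H U x p)
          (τ := τ) (τ' := τ') cluster_subset
          (fun u hu v hv hadj hvU => by
            obtain ⟨h1, h2⟩ := plus_of_adj_cluster hu hv hadj hvU
            rw [h1, h2])
          (fun u hu v _ hadj => hτ v (by rintro rfl; exact hp ⟨u, hu, hadj⟩))
        simp only [hF, hw]
        -- Either the swap exchanges the two indicators at `x`, or both spins at `x` are plus and
        -- the term vanishes.
        by_cases hxC : x ∈ cluster H U x p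
        · simp only [swapOn, hxC, if_true]; ring
        · obtain ⟨h1, h2⟩ := plus_of_notMem_cluster hx hxC
          simp [swapOn, hxC, h1, h2]
    rw [Finset.sum_neg_distrib] at hneg
    linarith
  rw [hsum, ← Finset.sum_filter_add_sum_filter_not Finset.univ
    (fun p => ∃ v ∈ cluster H U x p, H.Adj v y) F, hzero, add_zero]
  refine (Finset.abs_sum_le_sum_abs _ _).trans (Finset.sum_le_sum fun p _ => ?_)
  have hnn : 0 ≤ weight H β U τ p.1 * weight H β U τ' p.2 :=
    mul_nonneg (weight_nonneg ..) (weight_nonneg ..)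
  rw [hF, abs_mul, abs_of_nonneg hnn]
  refine mul_le_of_le_one_right hnn ?_
  split_ifs <;> simp

end Swapping


/-! ### Peierls estimate for the cluster -/

section Peierls

variable {X : Type*} [Fintype X] {H : SimpleGraph X} {U : Finset X} {x : X}

omit [Fintype X] in
theorem plusOn_injOn {A : Finset X} {σ σ' : X → ℤˣ} (h : ∀ u ∈ A, σ u = -1)
    (h' : ∀ u ∈ A, σ' u = -1) (he : plusOn A σ = plusOn A σ') : σ = σ' := by
  funext z
  by_cases hz : z ∈ A
  · rw [h z hz, h' z hz]
  · simpa [plusOn, hz] using congrFun he z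

open scoped Classical in
/-- The minus spins of `σ` in the set `C`. -/
noncomputable def minusIn (C : Finset X) (σ : X → ℤˣ) : Finset X := C.filter fun v => σ v = -1

omit [Fintype X] in
theorem eq_neg_one_of_mem_minusIn {C : Finset X} {σ : X → ℤˣ} :
    ∀ u ∈ minusIn C σ, σ u = -1 := by
  classical
  exact fun u hu => (Finset.mem_filter.mp hu).2

omit [Fintype X] in
theorem minusIn_subset (C : Finset X) (σ : X → ℤˣ) : minusIn C σ ⊆ C := by
  classical
  exact Finset.filter_subset _ _

omit [Fintype X] in
theorem eq_one_of_notMem_minusIn {C : Finset X} {σ : X → ℤˣ} {v : X} (hv : v ∈ C)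
    (h : v ∉ minusIn C σ) : σ v = 1 := by
  classical
  refine (Int.units_eq_one_or (σ v)).resolve_right fun hm => h ?_
  exact Finset.mem_filter.mpr ⟨hv, hm⟩

omit [Fintype X] in
/-- Upward neighbours of the minus spins of a cluster carry plus spins, if the boundary condition
is plus above `U`. -/
theorem eq_one_of_adj_minusIn {ℓ : X → ℕ} {C : Finset X} (hCU : C ⊆ U) {τ σ : X → ℤˣ}
    (hC : ∀ u ∈ C, ∀ v ∉ C, H.Adj u v → v ∈ U → σ v = 1)
    (hτ : ∀ u ∈ U, ∀ v ∉ U, H.Adj u v → ℓ u < ℓ v → τ v = 1) (hσ : ∀ z ∉ U, σ z = τ z) :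
    ∀ u ∈ minusIn C σ, ∀ v ∉ minusIn C σ, H.Adj u v → ℓ u < ℓ v → σ v = 1 := by
  intro u hu v hv hadj hlt
  have huC := minusIn_subset _ _ hu
  by_cases hvC : v ∈ C
  · exact eq_one_of_notMem_minusIn hvC hv
  · by_cases hvU : v ∈ U
    · exact hC u huC v hvC hadj hvU
    · rw [hσ v hvU, hτ u (hCU huC) v hvU hadj hlt]

theorem weight_le_weight_plusOn_minusIn {β : ℝ} (hβ : 0 ≤ β) {ℓ : X → ℕ} {g : ℝ}
    (hg : UpwardGrowth H ℓ U g) {C : Finset X} (hCU : C ⊆ U) {τ σ : X → ℤˣ}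
    (hC : ∀ u ∈ C, ∀ v ∉ C, H.Adj u v → v ∈ U → σ v = 1)
    (hτ : ∀ u ∈ U, ∀ v ∉ U, H.Adj u v → ℓ u < ℓ v → τ v = 1) :
    weight H β U τ σ ≤ Real.exp (-(2 * β * g)) ^ (minusIn C σ).card *
      weight H β U τ (plusOn (minusIn C σ) σ) := by
  by_cases hσ : ∀ z ∉ U, σ z = τ z
  · exact weight_le_weight_plusOn H hβ hg ((minusIn_subset _ _).trans hCU)
      eq_neg_one_of_mem_minusIn (eq_one_of_adj_minusIn hCU hC hτ hσ)
  · rw [weight, if_neg hσ]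
    exact mul_nonneg (by positivity) (weight_nonneg ..)

open scoped Classical in
theorem sum_weight_cluster_eq_le {β : ℝ} (hβ : 0 ≤ β) {ℓ : X → ℕ} {g : ℝ} (hg0 : 0 ≤ g)
    (hg : UpwardGrowth H ℓ U g) {τ τ' : X → ℤˣ}
    (hτ : ∀ u ∈ U, ∀ v ∉ U, H.Adj u v → ℓ u < ℓ v → τ v = 1)
    (hτ' : ∀ u ∈ U, ∀ v ∉ U, H.Adj u v → ℓ u < ℓ v → τ' v = 1) (C : Finset X) :
    ∑ p : (X → ℤˣ) × (X → ℤˣ) with cluster H U x p = C, weight H β U τ p.1 * weight H β U τ' p.2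
      ≤ (4 * Real.exp (-(2 * β * g))) ^ C.card *
        ((∑ σ, weight H β U τ σ) * ∑ σ, weight H β U τ' σ) := by
  set t := Real.exp (-(2 * β * g)) with ht
  have ht0 : 0 ≤ t := (Real.exp_pos _).le
  have ht1 : t ≤ 1 := by
    rw [ht, Real.exp_le_one_iff]; nlinarith [mul_nonneg hβ hg0]
  set W : (X → ℤˣ) × (X → ℤˣ) → ℝ := fun p => weight H β U τ p.1 * weight H β U τ' p.2 with hW
  have hWn : ∀ p, 0 ≤ W p := fun p => mul_nonneg (weight_nonneg ..) (weight_nonneg ..)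
  have hZ : (∑ σ, weight H β U τ σ) * ∑ σ, weight H β U τ' σ = ∑ p, W p := by
    rw [Finset.sum_mul_sum, Fintype.sum_prod_type]
  rw [hZ]
  have hmaps : ∀ p ∈ (Finset.univ.filter fun p => cluster H U x p = C),
      (minusIn C p.1, minusIn C p.2) ∈ C.powerset ×ˢ C.powerset := fun p _ => by
    simp [minusIn_subset]
  have hfib : ∀ k ∈ C.powerset ×ˢ C.powerset,
      ∑ p ∈ Finset.univ.filter (fun p => cluster H U x p = C) with
        (minusIn C p.1, minusIn C p.2) = k, W p ≤ t ^ C.card * ∑ p, W p := by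
    rintro ⟨A, B⟩ -
    set S := (Finset.univ.filter (fun p => cluster H U x p = C)).filter
      (fun p => (minusIn C p.1, minusIn C p.2) = (A, B)) with hS
    have hmem : ∀ p ∈ S, cluster H U x p = C ∧ minusIn C p.1 = A ∧ minusIn C p.2 = B := by
      intro p hp; simpa [hS] using hp
    -- Once the minus sets `A` and `B` are fixed, the flipped spins can be restored, so the images
    -- are distinct and their total weight is at most the full sum.
    have hinj : Set.InjOn (fun p : (X → ℤˣ) × (X → ℤˣ) => (plusOn A p.1, plusOn B p.2)) S := by
      intro p hp p' hp' he
      obtain ⟨-, hA, hB⟩ := hmem p hp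
      obtain ⟨-, hA', hB'⟩ := hmem p' hp'
      have he' := Prod.ext_iff.mp he
      refine Prod.ext (plusOn_injOn ?_ ?_ he'.1) (plusOn_injOn ?_ ?_ he'.2)
      · rw [← hA]; exact eq_neg_one_of_mem_minusIn
      · rw [← hA']; exact eq_neg_one_of_mem_minusIn
      · rw [← hB]; exact eq_neg_one_of_mem_minusIn
      · rw [← hB']; exact eq_neg_one_of_mem_minusIn
    have hle : ∀ p ∈ S, W p ≤ t ^ C.card * W (plusOn A p.1, plusOn B p.2) := by
      intro p hp
      obtain ⟨hc, hA, hB⟩ := hmem p hp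
      have hCU : C ⊆ U := hc ▸ cluster_subset
      have hplus : ∀ u ∈ C, ∀ v ∉ C, H.Adj u v → v ∈ U → p.1 v = 1 ∧ p.2 v = 1 := by
        subst hc
        exact fun u hu v hv hadj hvU => plus_of_adj_cluster hu hv hadj hvU
      have h1 := weight_le_weight_plusOn_minusIn hβ hg hCU (σ := p.1)
        (fun u hu v hv hadj hvU => (hplus u hu v hv hadj hvU).1) hτ
      have h2 := weight_le_weight_plusOn_minusIn hβ hg hCU (σ := p.2)
        (fun u hu v hv hadj hvU => (hplus u hu v hv hadj hvU).2) hτ'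
      rw [hA, ← ht] at h1
      rw [hB, ← ht] at h2
      -- Every vertex of the cluster is minus in at least one copy.
      have hcard : C.card ≤ A.card + B.card := by
        refine (Finset.card_le_card fun v hv => ?_).trans (Finset.card_union_le A B)
        by_contra hne
        rw [Finset.mem_union, not_or, ← hA, ← hB] at hne
        exact (cluster_spec (hc.symm ▸ hv : v ∈ cluster H U x p)).2
          ⟨eq_one_of_notMem_minusIn hv hne.1, eq_one_of_notMem_minusIn hv hne.2⟩
      calc W p ≤ (t ^ A.card * weight H β U τ (plusOn A p.1)) *
            (t ^ B.card * weight H β U τ' (plusOn B p.2)) :=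
            mul_le_mul h1 h2 (weight_nonneg ..) (mul_nonneg (by positivity) (weight_nonneg ..))
        _ = t ^ (A.card + B.card) * W (plusOn A p.1, plusOn B p.2) := by
            simp only [hW]; ring
        _ ≤ _ := mul_le_mul_of_nonneg_right (pow_le_pow_of_le_one ht0 ht1 hcard) (hWn _)
    refine (Finset.sum_le_sum hle).trans ?_
    rw [← Finset.mul_sum]
    refine mul_le_mul_of_nonneg_left ?_ (by positivity)
    rw [← Finset.sum_image (f := W) hinj]
    exact Finset.sum_le_univ_sum_of_nonneg hWn
  rw [← Finset.sum_fiberwise_of_maps_to hmaps]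
  refine (Finset.sum_le_card_nsmul _ _ _ hfib).trans_eq ?_
  rw [Finset.card_product, Finset.card_powerset, nsmul_eq_mul, mul_pow, ← mul_assoc]
  congr 2
  push_cast
  rw [← mul_pow]
  norm_num

open scoped Classical in
theorem sum_weight_adj_cluster_le {Δ : ℕ} (hΔ : ∀ u, H.degree u ≤ Δ) {β : ℝ} (hβ : 0 ≤ β)
    {ℓ : X → ℕ} {g : ℝ} (hg0 : 0 ≤ g) (hg : UpwardGrowth H ℓ U g) {τ τ' : X → ℤˣ}
    (hτ : ∀ u ∈ U, ∀ v ∉ U, H.Adj u v → ℓ u < ℓ v → τ v = 1)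
    (hτ' : ∀ u ∈ U, ∀ v ∉ U, H.Adj u v → ℓ u < ℓ v → τ' v = 1) {y : X} {d : ℕ}
    (hd : ∀ q : H.Walk x y, d ≤ q.length) {q : ℝ}
    (hq : q = 4 * (Δ + 1) ^ 2 * Real.exp (-(2 * β * g))) (hq1 : q < 1) :
    ∑ p : (X → ℤˣ) × (X → ℤˣ) with ∃ v ∈ cluster H U x p, H.Adj v y,
        weight H β U τ p.1 * weight H β U τ' p.2
      ≤ q ^ d / (1 - q) * ((∑ σ, weight H β U τ σ) * ∑ σ, weight H β U τ' σ) := by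
  set t := Real.exp (-(2 * β * g)) with ht
  set Z := (∑ σ, weight H β U τ σ) * ∑ σ, weight H β U τ' σ with hZ
  have hZ0 : 0 ≤ Z := mul_nonneg (sum_weight_pos ..).le (sum_weight_pos ..).le
  have hq0 : 0 ≤ q := by rw [hq]; positivity
  set W : (X → ℤˣ) × (X → ℤˣ) → ℝ := fun p => weight H β U τ p.1 * weight H β U τ' p.2 with hW
  have hWn : ∀ p, 0 ≤ W p := fun p => mul_nonneg (weight_nonneg ..) (weight_nonneg ..)
  set E := Finset.univ.filter (fun p => ∃ v ∈ cluster H U x p, H.Adj v y) with hE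
  have hmaps : ∀ p ∈ E, (cluster H U x p).card ∈ Finset.Ico d (Fintype.card X + 1) := by
    intro p hp
    obtain ⟨v, hv, hadj⟩ : ∃ v ∈ cluster H U x p, H.Adj v y := by simpa [hE] using hp
    exact Finset.mem_Ico.mpr
      ⟨le_card_cluster_of_adj hd hv hadj, Nat.lt_succ_of_le (Finset.card_le_univ _)⟩
  rw [← Finset.sum_fiberwise_of_maps_to hmaps]
  have hn : ∀ n ∈ Finset.Ico d (Fintype.card X + 1),
      ∑ p ∈ E with (cluster H U x p).card = n, W p ≤ q ^ n * Z := by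
    intro n _
    have hmaps' : ∀ p ∈ E.filter (fun p => (cluster H U x p).card = n),
        cluster H U x p ∈ walkSupports H (2 * (n - 1)) x := by
      intro p hp
      obtain ⟨⟨v, hv, -⟩, rfl⟩ : (∃ v ∈ cluster H U x p, H.Adj v y) ∧
        (cluster H U x p).card = n := by simpa [hE] using hp
      exact cluster_mem_walkSupports ⟨v, hv⟩
    rw [← Finset.sum_fiberwise_of_maps_to hmaps']
    have hC : ∀ C ∈ walkSupports H (2 * (n - 1)) x,
        ∑ p ∈ E.filter (fun p => (cluster H U x p).card = n) with cluster H U x p = C, W p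
          ≤ (4 * t) ^ n * Z := by
      intro C _
      by_cases hCn : C.card = n
      · rw [← hCn]
        refine le_trans (Finset.sum_le_sum_of_subset_of_nonneg ?_ fun p _ _ => hWn p)
          (sum_weight_cluster_eq_le (x := x) hβ hg0 hg hτ hτ' C)
        intro p hp
        exact Finset.mem_filter.mpr ⟨Finset.mem_univ _, (Finset.mem_filter.mp hp).2⟩
      -- `walkSupports` also contains sets of other sizes; these do not occur as clusters here.
      · rw [Finset.sum_eq_zero]
        · positivity
        · intro p hp
          simp only [Finset.mem_filter] at hp
          exact absurd (hp.2 ▸ hp.1.2) hCn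
    refine (Finset.sum_le_card_nsmul _ _ _ hC).trans ?_
    -- The base `Δ + 1` is at least 1 even for `Δ = 0`, so the exponent may be raised to `2 * n`.
    have hcard : ((walkSupports H (2 * (n - 1)) x).card : ℝ) ≤ ((Δ : ℝ) + 1) ^ (2 * n) := by
      have h1 : (walkSupports H (2 * (n - 1)) x).card ≤ (Δ + 1) ^ (2 * n) :=
        (card_walkSupports_le H (fun u => (hΔ u).trans Δ.le_succ) _ x).trans
          (Nat.pow_le_pow_right Δ.succ_pos (by omega))
      exact_mod_cast h1
    rw [nsmul_eq_mul]
    refine (mul_le_mul_of_nonneg_right hcard (by positivity)).trans_eq ?_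
    rw [hq, ← mul_assoc, pow_mul, ← mul_pow]
    ring
  refine (Finset.sum_le_sum hn).trans ?_
  rw [← Finset.sum_mul]
  exact mul_le_mul_of_nonneg_right (geom_sum_Ico_le_of_lt_one hq0 hq1) hZ0

open scoped Classical in
/-- Exponential decay of the influence of the boundary spin at `y` on the spin at `x`. -/
theorem abs_div_sub_div_le {Δ : ℕ} (hΔ : ∀ u, H.degree u ≤ Δ) {β : ℝ} (hβ : 0 ≤ β)
    {ℓ : X → ℕ} {g : ℝ} (hg0 : 0 ≤ g) (hg : UpwardGrowth H ℓ U g) (hx : x ∈ U) {y : X}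
    {τ τ' : X → ℤˣ} (hne : ∀ v, v ≠ y → τ v = τ' v)
    (hτ : ∀ u ∈ U, ∀ v ∉ U, H.Adj u v → ℓ u < ℓ v → τ v = 1)
    (hτ' : ∀ u ∈ U, ∀ v ∉ U, H.Adj u v → ℓ u < ℓ v → τ' v = 1) {d : ℕ}
    (hd : ∀ q : H.Walk x y, d ≤ q.length) {q : ℝ}
    (hq : q = 4 * (Δ + 1) ^ 2 * Real.exp (-(2 * β * g))) (hq1 : q < 1) :
    |(∑ σ, if σ x = 1 then weight H β U τ σ else 0) / ∑ σ, weight H β U τ σ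
      - (∑ σ, if σ x = 1 then weight H β U τ' σ else 0) / ∑ σ, weight H β U τ' σ|
      ≤ q ^ d / (1 - q) := by
  have hZ := sum_weight_pos H β U τ
  have hZ' := sum_weight_pos H β U τ'
  rw [div_sub_div _ _ hZ.ne' hZ'.ne', abs_div, abs_of_pos (mul_pos hZ hZ'),
    div_le_iff₀ (mul_pos hZ hZ'), mul_comm (∑ σ, weight H β U τ σ) (∑ σ, if σ x = 1 then weight H β U τ' σ else 0)]
  exact (abs_sub_le_sum_adj_cluster β hx hne).trans
    (sum_weight_adj_cluster_le hΔ hβ hg0 hg hτ hτ' hd hq hq1)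

end Peierls


/-! ### From abstract weights to the Gibbs measures -/

section Transfer

open scoped Classical in
-- Every edge carries two darts. This reconciles `interaction`, a sum over edges, with `energy`, a
-- sum over ordered pairs.
theorem two_mul_sum_edgeFinset {X : Type*} [Fintype X] (H : SimpleGraph X) (f : X → X → ℝ)
    (hf : ∀ u v, f u v = f v u) :
    2 * ∑ e ∈ H.edgeFinset, e.lift ⟨f, hf⟩ = ∑ u, ∑ v, if H.Adj u v then f u v else 0 := by
  have h1 : ∑ d : H.Dart, f d.fst d.snd = 2 * ∑ e ∈ H.edgeFinset, e.lift ⟨f, hf⟩ := by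
    rw [← Finset.sum_fiberwise_of_maps_to (s := Finset.univ) (t := H.edgeFinset)
      (g := fun d : H.Dart => d.edge) (fun d _ => by simp), Finset.mul_sum]
    refine Finset.sum_congr rfl fun e he => ?_
    rw [Finset.sum_congr rfl (g := fun _ => e.lift ⟨f, hf⟩), Finset.sum_const,
      H.dart_edge_fiber_card e (by simpa using he), nsmul_eq_mul]
    · norm_num
    · intro d hd
      rw [← (Finset.mem_filter.mp hd).2]
      rfl
  rw [← h1, ← Fintype.sum_prod_type' (f := fun u v => if H.Adj u v then f u v else 0),
    ← Finset.sum_filter]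
  refine Finset.sum_bij (fun d _ => d.toProd) ?_ ?_ ?_ ?_
  · intro d _; simp
  · intro d _ d' _ h; exact SimpleGraph.Dart.ext _ _ h
  · rintro p hp; exact ⟨⟨p, by simpa using hp⟩, Finset.mem_univ _, rfl⟩
  · intro d _; rfl

variable {V : Type*} (G : SimpleGraph V) [G.LocallyFinite]

/-- The subgraph of `G` induced on `A ∪ ∂_V A`. -/
abbrev closureGraph (A : Finset V) : SimpleGraph {x // x ∈ closure G A} := G.comap Subtype.val

open scoped Classical in
/-- The set `A` as a subset of `A ∪ ∂_V A`. -/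
noncomputable def interior (A : Finset V) : Finset {x // x ∈ closure G A} :=
  Finset.univ.filter fun z => (z : V) ∈ A

variable {G}

theorem mem_interior {A : Finset V} {z : {x // x ∈ closure G A}} :
    z ∈ interior G A ↔ (z : V) ∈ A := by simp [interior]

theorem mem_vertexBoundary {A : Finset V} {v : V} :
    v ∈ vertexBoundary G A ↔ (∃ u ∈ A, G.Adj u v) ∧ v ∉ A := by
  simp [vertexBoundary]

theorem mem_closure_of_mem {A : Finset V} {v : V} (h : v ∈ A) : v ∈ closure G A := by
  classical
  exact Finset.mem_union_left _ h

theorem mem_closure_of_adj {A : Finset V} {u v : V} (h : u ∈ A) (hadj : G.Adj u v) :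
    v ∈ closure G A := by
  classical
  by_cases hv : v ∈ A
  · exact mem_closure_of_mem hv
  · exact Finset.mem_union_right _ (mem_vertexBoundary.mpr ⟨⟨u, h, hadj⟩, hv⟩)

theorem weight_closureGraph (β : ℝ) (A : Finset V) (η : V → ℤˣ) (σ : Config G A)
    [Decidable (σ ∈ Omega G A η)] :
    weight (closureGraph G A) β (interior G A) (fun z => η z) σ =
      if σ ∈ Omega G A η then Real.exp (β * interaction G A σ) else 0 := by
  classical
  have h1 : (∀ z ∉ interior G A, σ z = η z) ↔ σ ∈ Omega G A η := by
    refine forall_congr' fun z => ?_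
    have hz : z ∉ interior G A ↔ (z : V) ∈ vertexBoundary G A := by
      have hz' := Finset.mem_union.mp z.2
      rw [mem_interior]
      constructor
      · tauto
      · exact fun h => (mem_vertexBoundary.mp h).2
    rw [hz]
  have h2 : energy (closureGraph G A) σ = 2 * interaction G A σ := by
    unfold energy interaction
    rw [← two_mul_sum_edgeFinset (closureGraph G A) (fun u v => ((σ u : ℤ) : ℝ) * ((σ v : ℤ) : ℝ))
      fun _ _ => mul_comm _ _]
    congr!
  unfold weight
  rw [h2]
  by_cases h : σ ∈ Omega G A η
  · rw [if_pos (h1.mpr h), if_pos h]; ring_nf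
  · rw [if_neg (mt h1.mp h), if_neg h]

open scoped Classical in
theorem gibbsProb_plusAt (β : ℝ) (A : Finset V) (η : V → ℤˣ) {x : V} (hx : x ∈ closure G A) :
    gibbsProb G β A η (plusAt G A x) =
      (∑ σ : {x // x ∈ closure G A} → ℤˣ, if σ ⟨x, hx⟩ = 1 then
        weight (closureGraph G A) β (interior G A) (fun z => η z) σ else 0) /
      ∑ σ : {x // x ∈ closure G A} → ℤˣ,
        weight (closureGraph G A) β (interior G A) (fun z => η z) σ := by
  have hZ : partitionFunction G β A η = ∑ σ : {x // x ∈ closure G A} → ℤˣ,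
      weight (closureGraph G A) β (interior G A) (fun z => η z) σ := by
    unfold partitionFunction
    rw [Finset.sum_filter]
    simp only [weight_closureGraph]
  rw [← hZ, Finset.sum_div, gibbsProb, Finset.sum_filter]
  have hmem : ∀ σ : Config G A, σ ∈ plusAt G A x ↔ σ ⟨x, hx⟩ = 1 := fun σ => by
    simp [plusAt, hx]
  have hterm : ∀ σ : Config G A, (if σ ∈ plusAt G A x then gibbs G β A η σ else 0) =
      (if σ ⟨x, hx⟩ = 1 then
        weight (closureGraph G A) β (interior G A) (fun z => η z) σ else 0)
        / partitionFunction G β A η := by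
    intro σ
    rw [weight_closureGraph, gibbs]
    by_cases h1 : σ ⟨x, hx⟩ = 1 <;> by_cases h2 : σ ∈ Omega G A η <;> simp [hmem, h1, h2]
  simp only [hterm]

theorem degree_closureGraph_le (A : Finset V) (u : {x // x ∈ closure G A})
    [Fintype ((closureGraph G A).neighborSet u)] :
    (closureGraph G A).degree u ≤ G.degree u := by
  classical
  rw [← SimpleGraph.card_neighborFinset_eq_degree, ← SimpleGraph.card_neighborFinset_eq_degree]
  refine Finset.card_le_card_of_injOn Subtype.val ?_ Subtype.val_injective.injOn
  intro v hv
  simpa using hv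

theorem dist_le_length_walk_closureGraph {A : Finset V} {x y : {x // x ∈ closure G A}}
    (p : (closureGraph G A).Walk x y) : G.dist x y ≤ p.length := by
  have h := SimpleGraph.dist_le (p.map (SimpleGraph.Hom.comap (Subtype.val) G))
  rwa [SimpleGraph.Walk.length_map] at h

omit [G.LocallyFinite] in
theorem mem_level_iff (hG : G.Connected) {o v : V} {r : ℕ} : v ∈ level G o r ↔ G.dist o v = r := by
  rw [level, Set.mem_ofPred_eq, ← (hG o v).coe_dist_eq_edist]
  exact Nat.cast_inj

omit [G.LocallyFinite] in
theorem mem_ballSet_iff (hG : G.Connected) {o v : V} {r : ℕ} :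
    v ∈ ballSet G o r ↔ G.dist o v ≤ r := by
  rw [ballSet, Set.mem_ofPred_eq, ← (hG o v).coe_dist_eq_edist]
  exact Nat.cast_le

theorem mem_ball_iff (hG : G.Connected) {o v : V} {r : ℕ} : v ∈ ball G o r ↔ G.dist o v ≤ r := by
  rw [ball, Set.Finite.mem_toFinset, mem_ballSet_iff hG]

theorem mem_region_iff (hG : G.Connected) {o v : V} {m i : ℕ} {S : Finset V} :
    v ∈ region G o m i S ↔ (G.dist o v ≤ m ∧ i + 1 ≤ G.dist o v) ∨ v ∈ S := by
  classical
  rw [region, Finset.mem_union, outerLayers, Finset.mem_filter, mem_ball_iff hG,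
    ← (hG o v).coe_dist_eq_edist, Nat.cast_le]

omit [G.LocallyFinite] in
theorem dist_le_dist_add_one_of_adj (hG : G.Connected) (o : V) {u v : V} (h : G.Adj u v) :
    G.dist o v ≤ G.dist o u + 1 := by
  have := hG.dist_triangle (u := o) (v := u) (w := v)
  rwa [SimpleGraph.dist_eq_one_iff_adj.mpr h] at this

/-- All `G`-neighbours of a vertex of `A` lie in `closure G A`, so the count in the finite graph is
the count in `G`. Heights of neighbours differ by at most 1, so "higher" means "on the next level".
-/
theorem IsGrowing.upwardGrowth {g : ℕ} {o : V} (hg : IsGrowing G g o) (hG : G.Connected)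
    (A : Finset V) :
    UpwardGrowth (closureGraph G A) (fun z => G.dist o z) (interior G A) g := by
  classical
  intro u hu
  rw [mem_interior] at hu
  obtain ⟨u, hu'⟩ := u
  have h1 : (∑ v : {x // x ∈ closure G A}, if (closureGraph G A).Adj ⟨u, hu'⟩ v then
      (if G.dist o u < G.dist o v then (1 : ℝ) else -1) else 0)
      = ∑ v ∈ G.neighborFinset u, if G.dist o u < G.dist o v then (1 : ℝ) else -1 := by
    rw [← Finset.sum_filter]
    refine Finset.sum_bij (fun v _ => (v : V)) ?_ ?_ ?_ ?_
    · intro v hv; simpa using hv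
    · intro v _ w _ h; exact Subtype.ext h
    · intro v hv
      rw [SimpleGraph.mem_neighborFinset] at hv
      exact ⟨⟨v, mem_closure_of_adj hu hv⟩, by simpa using hv, rfl⟩
    · intro v _; rfl
  have h2 : (G.neighborSet u ∩ level G o (G.dist o u + 1)) =
      ((G.neighborFinset u).filter fun v => G.dist o u < G.dist o v : Finset V) := by
    ext v
    rw [Set.mem_inter_iff, mem_level_iff hG, Finset.coe_filter, Set.mem_ofPred_eq,
      SimpleGraph.mem_neighborFinset, SimpleGraph.mem_neighborSet]
    refine and_congr_right fun h => ?_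
    have := dist_le_dist_add_one_of_adj hG o h
    omega
  have h3 : (G.neighborSet u ∩ ballSet G o (G.dist o u)) =
      ((G.neighborFinset u).filter fun v => ¬ G.dist o u < G.dist o v : Finset V) := by
    ext v
    rw [Set.mem_inter_iff, mem_ballSet_iff hG, Finset.coe_filter, Set.mem_ofPred_eq,
      SimpleGraph.mem_neighborFinset, SimpleGraph.mem_neighborSet, not_lt]
  have h4 := hg.isLeast.2 ⟨G.dist o u, u, (mem_level_iff hG).mpr rfl, rfl⟩
  rw [h2, h3, Set.ncard_coe_finset, Set.ncard_coe_finset] at h4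
  have h5 : (g : ℝ) ≤
      (((G.neighborFinset u).filter fun v => G.dist o u < G.dist o v).card : ℝ)
      - (((G.neighborFinset u).filter fun v => ¬ G.dist o u < G.dist o v).card : ℝ) := by
    exact_mod_cast h4
  refine h5.trans_eq (Eq.trans ?_ (h1.symm.trans ?_))
  · rw [Finset.sum_ite, Finset.sum_const, Finset.sum_const]
    simp [sub_eq_add_neg]
  · congr!

/-- Exponential decay of the influence of the boundary spin at `y` on the spin at `x`, for Gibbs
measures on a finite set in which every vertex has an excess of at least `g` upward neighbours. -/
theorem abs_gibbsProb_sub_le {Δ : ℕ} (hΔ : ∀ v, G.degree v ≤ Δ) {β : ℝ} (hβ : 0 ≤ β)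
    {g : ℕ} {o : V} (hg : IsGrowing G g o) (hG : G.Connected) {A : Finset V} {x y : V}
    (hx : x ∈ A) {τ τ' : V → ℤˣ} (hne : ∀ v, v ≠ y → τ v = τ' v)
    (hup : ∀ u ∈ A, ∀ v ∉ A, G.Adj u v → G.dist o u < G.dist o v → τ v = 1 ∧ τ' v = 1) {q : ℝ}
    (hq : q = 4 * (Δ + 1) ^ 2 * Real.exp (-(2 * β * g))) (hq1 : q < 1) :
    |gibbsProb G β A τ (plusAt G A x) - gibbsProb G β A τ' (plusAt G A x)|
      ≤ q ^ G.dist x y / (1 - q) := by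
  classical
  have hxc := mem_closure_of_mem (G := G) hx
  rw [gibbsProb_plusAt β A τ hxc, gibbsProb_plusAt β A τ' hxc]
  by_cases hyc : y ∈ GrowingIsing.closure G A
  · have hup₁ : ∀ u ∈ interior G A, ∀ v ∉ interior G A, (closureGraph G A).Adj u v →
        G.dist o u < G.dist o v → τ v = 1 ∧ τ' v = 1 := fun u hu v hv hadj =>
      hup u (mem_interior.mp hu) v (mt mem_interior.mpr hv) hadj
    convert abs_div_sub_div_le (H := closureGraph G A) (U := interior G A) (x := ⟨x, hxc⟩)
      (y := ⟨y, hyc⟩) (τ := fun z => τ z) (τ' := fun z => τ' z) (ℓ := fun z => G.dist o z)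
      (fun u => (degree_closureGraph_le A u).trans (hΔ u)) hβ (Nat.cast_nonneg g)
      (hg.upwardGrowth hG A) (mem_interior.mpr hx)
      (fun v hv => hne v fun h => hv (Subtype.ext h))
      (fun u hu v hv hadj hlt => (hup₁ u hu v hv hadj hlt).1)
      (fun u hu v hv hadj hlt => (hup₁ u hu v hv hadj hlt).2)
      (fun p => dist_le_length_walk_closureGraph p) hq hq1
  -- Here `y` lies outside `closure G A`, so the two boundary conditions agree on it and the
  -- difference is 0.
  · have heq : (fun z : {z // z ∈ GrowingIsing.closure G A} => τ' z) = fun z => τ z.1 :=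
      funext fun z => (hne z.1 fun h => hyc (h ▸ z.2)).symm
    rw [heq, sub_self, abs_zero]
    have : 0 ≤ q := by rw [hq]; positivity
    exact div_nonneg (pow_nonneg this _) (by linarith)

end Transfer

end GrowingIsing

/-! ### Choice of constants and check of the boundary condition -/

theorem proposition3p1 (Δ : ℕ) :
    ∃ δ : ℝ, 0 < δ ∧
      ∀ (g : ℕ) (β : ℝ), 0 < g → δ / (2 * g) < β →
        ∃ c : ℝ, 0 < c ∧
          ∀ (V : Type*) (G : SimpleGraph V) [G.LocallyFinite] (o : V),
            G.Connected → GrowingIsing.IsGrowing G g o →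
            IsGreatest (Set.range fun v : V => G.degree v) Δ →
            ∀ (m i : ℕ), i ≤ m →
            ∀ (S : Finset V), (S : Set V) ⊆ GrowingIsing.level G o i →
            ∀ x ∈ S, ∀ y ∈ GrowingIsing.level G o i, y ∉ S →
            ∀ τ : V → ℤˣ,
              (∀ z ∈ GrowingIsing.vertexBoundary G (GrowingIsing.ball G o m), τ z = 1) →
              |GrowingIsing.gibbsProb G β (GrowingIsing.region G o m i S) τ
                  (GrowingIsing.plusAt G (GrowingIsing.region G o m i S) x)
                - GrowingIsing.gibbsProb G β (GrowingIsing.region G o m i S)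
                  (GrowingIsing.flipAt τ y)
                  (GrowingIsing.plusAt G (GrowingIsing.region G o m i S) x)|
              ≤ c * Real.exp (-(2 * g * β - δ) * G.dist x y) := by
  have hK : (4 : ℝ) ≤ 4 * (Δ + 1) ^ 2 := by nlinarith [Nat.cast_nonneg (α := ℝ) Δ]
  have hδ : 0 < Real.log (4 * (Δ + 1) ^ 2) := Real.log_pos (by linarith)
  -- This `δ` absorbs the entropy factor: the ratio of the series becomes `exp(-(2gβ - δ))`, which
  -- is below 1 exactly when `β > δ / (2g)`.
  refine ⟨Real.log (4 * (Δ + 1) ^ 2), hδ, fun g β hg hβ => ?_⟩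
  set δ := Real.log (4 * ((Δ : ℝ) + 1) ^ 2) with hδdef
  have hg' : (0 : ℝ) < g := Nat.cast_pos.mpr hg
  have hβ0 : 0 < β := lt_trans (by positivity) hβ
  have hpos : 0 < 2 * g * β - δ := by
    rw [div_lt_iff₀ (by positivity)] at hβ; linarith
  set q := Real.exp (-(2 * g * β - δ)) with hqdef
  have hq1 : q < 1 := by rw [hqdef, Real.exp_lt_one_iff]; linarith
  have hq : q = 4 * (Δ + 1) ^ 2 * Real.exp (-(2 * β * g)) := by
    rw [hqdef, ← Real.exp_log (show (0 : ℝ) < 4 * (Δ + 1) ^ 2 by linarith), ← hδdef,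
      ← Real.exp_add]
    ring_nf
  refine ⟨1 / (1 - q), one_div_pos.mpr (by linarith), ?_⟩
  intro V G _ o hG hgrow hΔ m i him S hS x hx y hy _ τ hτ
  have hbound : Real.exp (-(2 * g * β - δ) * G.dist x y) = q ^ G.dist x y := by
    rw [hqdef, ← Real.exp_nat_mul, mul_comm]
  have hxA : x ∈ GrowingIsing.region G o m i S :=
    (GrowingIsing.mem_region_iff hG).mpr (Or.inr hx)
  have hflip : ∀ v, v ≠ y → τ v = GrowingIsing.flipAt τ y v := fun v hv => by
    classical
    simp [GrowingIsing.flipAt, Function.update_of_ne hv]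
  rw [hbound, one_div, mul_comm, ← div_eq_mul_inv]
  refine GrowingIsing.abs_gibbsProb_sub_le (fun v => hΔ.2 ⟨v, rfl⟩) hβ0.le hgrow hG hxA hflip ?_
    hq hq1
  intro u hu v hv hadj hlt
  rw [GrowingIsing.mem_region_iff hG] at hu hv
  rw [GrowingIsing.mem_level_iff hG] at hy
  have hle : i ≤ G.dist o u ∧ G.dist o u ≤ m := by
    rcases hu with hu | hu
    · omega
    · have := (GrowingIsing.mem_level_iff hG).mp (hS hu)
      omega
  -- An upward neighbour of `U` has height above `i`, so it can lie outside `U` only by lying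
  -- outside `B_m`.
  have h1 : τ v = 1 := by
    refine hτ v (GrowingIsing.mem_vertexBoundary.mpr ⟨⟨u, ?_, hadj⟩, ?_⟩)
    · rw [GrowingIsing.mem_ball_iff hG]; exact hle.2
    · rw [GrowingIsing.mem_ball_iff hG]
      exact fun h => hv (Or.inl ⟨h, by omega⟩)
  -- `y` has height `i`, the lowest height in `U`, so it is above no vertex of `U` and flipping it
  -- leaves the plus condition intact.
  have hvy : v ≠ y := by
    rintro rfl
    omega
  exact ⟨h1, hflip v hvy ▸ h1⟩
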